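/- Let $n,r$ be positive integers and let $\mathcal A=(\mathcal A_1,\dots,\mathcal A_r)$ be a family of finite subsets of $(\mathbb Z_{\ge 0})^n$ such that $\dim\big(\sum_{j\in J}\mathcal A_j\big)\ge \#J$ for every $J\subseteq\{1,\dots,r\}$ (the dimension of a set being that of its affine hull in $\mathbb R^n$). For $1\le j\le r$ let $f_j=\sum_{a\in\mathcal A_j}C_{j,a}X^a$, where the $C_{j,a}$ are indeterminates, let $K=\mathbb Q(C_{j,a} : 1\le j\le r,\ a\in\mathcal A_j)$, and let $\overline K$ be an algebraic closure of $K$. Let $V^*(\mathbf f)\subseteq\overline K^n$ be the Zariski closure of $\{x\in(\overline K\setminus\{0\})^n : f_1(x)=\dots=f_r(x)=0\}$. For $\ell\le n$ let $\pi:\overline K^n\to\overline K^\ell$, $\pi(x_1,\dots,x_n)=(x_1,\dots,x_\ell)$. For a set $V\subseteq\overline K^m$ denote by $I(V)\subseteq K[X_1,\dots,X_m]$ the ideal of the polynomials over $K$ vanishing on $V$, and by $K(V)$ the fraction field of $K[X_1,\dots,X_m]/I(V)$ when $V$ is an irreducible $K$-variety. For an ideal $I$ and an element $h$ of a commutative ring,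 $I:h^\infty=\{g : h^m g\in I \text{ for some } m\ge 0\}$. Let $t\le\ell$ with $t+r\le n$ be such that $\{X_1,\dots,X_t\}$ is a transcendence basis of $K(\overline{\pi(V^*(\mathbf f))})$ over $K$ and $\{X_1,\dots,X_t,X_{t+r+1},\dots,X_n\}$ is a transcendence basis of $K(V^*(\mathbf f))$ over $K$. Then $\ell\le t+r$, and there is a Zariski dense open set $\mathcal O\subseteq\overline K^{\,n-t-r}$ such that, for every $b\in K^{n-t-r}\cap\mathcal O$, $$I\big(\overline{\pi(V^*(\mathbf f))}\big)=\Big(\big(f_1(X_1,\dots,X_{t+r},b),\dots,f_r(X_1,\dots,X_{t+r},b)\big):(X_1\cdots X_{t+r})^\infty\Big)\cap K[X_1,\dots,X_\ell].$$ -/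

import Mathlib

namespace ToricProjection

open MvPolynomial
open scoped Pointwise

noncomputable section

/-! ### Affine varieties over an algebraically closed extension `L` of a field `k` -/

section Varieties

variable {σ : Type*}

/-- The Zariski closure in the affine space `L ^ σ`. -/
def zariskiClosure {L : Type*} [Field L] (S : Set (σ → L)) : Set (σ → L) :=
  zeroLocus L (vanishingIdeal L S)

/-- Zariski open sets of `L ^ σ`: complements of zero sets of polynomials. -/
def IsZariskiOpen {L : Type*} [Field L] (U : Set (σ → L)) : Prop :=
  ∃ I : Ideal (MvPolynomial σ L), U = (zeroLocus L I)ᶜ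

/-- Zariski dense sets of `L ^ σ`. -/
def IsZariskiDense {L : Type*} [Field L] (U : Set (σ → L)) : Prop :=
  zariskiClosure U = Set.univ

/-- The function field `k(V)`: the fraction field of the coordinate ring `k[X] / I(V)`, where
`I(V)` is the ideal of the polynomials over `k` vanishing on `V`. (It is a field when `V` is
irreducible over `k`; in general this is the total ring of fractions.) -/
abbrev FunctionField (k : Type*) [Field k] {L : Type*} [Field L] [Algebra k L]
    (V : Set (σ → L)) : Type _ :=
  FractionRing (MvPolynomial σ k ⧸ vanishingIdeal k V)

/-- The class of the variable `X i` in `k(V)`. -/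
def coordFunction (k : Type*) [Field k] {L : Type*} [Field L] [Algebra k L]
    (V : Set (σ → L)) (i : σ) : FunctionField k V :=
  algebraMap (MvPolynomial σ k ⧸ vanishingIdeal k V) (FunctionField k V)
    (Ideal.Quotient.mk (vanishingIdeal k V) (X i))

/-- `V^*(f)`: the Zariski closure of the set of the common zeros of `f` all of whose coordinates
are nonzero. -/
def Vstar {k : Type*} [Field k] (L : Type*) [Field L] [Algebra k L] {r : ℕ}
    (f : Fin r → MvPolynomial σ k) : Set (σ → L) :=
  zariskiClosure {x : σ → L | (∀ j, aeval x (f j) = 0) ∧ ∀ i, x i ≠ 0}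

end Varieties

/-- The projection `(x_1, …, x_n) ↦ (x_1, …, x_l)`. -/
def proj (L : Type*) {l n : ℕ} (h : l ≤ n) (x : Fin n → L) : Fin l → L :=
  fun i => x (Fin.castLE h i)

/-- The saturation `I : h^∞`. -/
def saturation {R : Type*} [CommRing R] (I : Ideal R) (h : R) : Ideal R where
  carrier := {g | ∃ m : ℕ, h ^ m * g ∈ I}
  zero_mem' := ⟨0, by simp⟩
  add_mem' := by
    rintro a b ⟨p, hp⟩ ⟨q, hq⟩
    refine ⟨p + q, ?_⟩
    have e : h ^ (p + q) * (a + b) = h ^ q * (h ^ p * a) + h ^ p * (h ^ q * b) := by ring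
    rw [e]
    exact I.add_mem (I.mul_mem_left _ hp) (I.mul_mem_left _ hq)
  smul_mem' := by
    rintro c a ⟨p, hp⟩
    refine ⟨p, ?_⟩
    have e : h ^ p * (c • a) = c * (h ^ p * a) := by rw [smul_eq_mul]; ring
    rw [e]
    exact I.mul_mem_left _ hp

/-! ### Generic sparse systems -/

section Generic

variable {n r : ℕ}

/-- The dimension of the Minkowski sum of the supports `A j`, `j ∈ J`: the dimension of its
affine hull in `ℝ ^ n`. -/
def minkowskiDim (A : Fin r → Finset (Fin n →₀ ℕ)) (J : Finset (Fin r)) : ℕ :=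
  Module.finrank ℝ (vectorSpan ℝ
    (∑ j ∈ J, (fun (a : Fin n →₀ ℕ) (i : Fin n) => (a i : ℝ)) '' (A j : Set (Fin n →₀ ℕ))))

/-- The index set of the coefficients: the pairs `(j, a)` with `a ∈ A j`. -/
abbrev CoeffIndex (A : Fin r → Finset (Fin n →₀ ℕ)) : Type :=
  (j : Fin r) × {a : Fin n →₀ ℕ // a ∈ A j}

/-- The field `K = ℚ(C_{j,a})` of rational functions in the indeterminate coefficients. -/
abbrev CoeffField (A : Fin r → Finset (Fin n →₀ ℕ)) : Type :=
  FractionRing (MvPolynomial (CoeffIndex A) ℚ)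

/-- The generic polynomial `f_j = ∑_{a ∈ A j} C_{j,a} X^a`. -/
def genericPoly (A : Fin r → Finset (Fin n →₀ ℕ)) (j : Fin r) :
    MvPolynomial (Fin n) (CoeffField A) :=
  ∑ a : {a : Fin n →₀ ℕ // a ∈ A j},
    monomial a.1
      (algebraMap (MvPolynomial (CoeffIndex A) ℚ) (CoeffField A) (X (⟨j, a⟩ : CoeffIndex A)))

end Generic

/-- The specialization `f ↦ f(X_1, …, X_s, b)`, where `b` has `n - s` coordinates. -/
def specialize {K : Type*} [CommRing K] (n s : ℕ) (b : Fin (n - s) → K) :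
    MvPolynomial (Fin n) K →ₐ[K] MvPolynomial (Fin s) K :=
  aeval fun i : Fin n =>
    if h : (i : ℕ) < s then X ⟨i, h⟩ else C (b ⟨i - s, by omega⟩)

end

end ToricProjection

open ToricProjection MvPolynomial

/-! ### Lifting prime ideals along generically finite extensions -/

section Lifting

/-! Write P for (f) : (X_1⋯X_n)^∞ in K[X]. A generic system is linear in its coefficients, so on the
torus each f_j = 0 can be solved for one C_{j,a}; hence P is prime if proper
(`isPrime_saturation_genericPoly`). By the Nullstellensatz P = I(V^*(f)) (`vanishingIdeal_Vstar`),
and the ideal of the projection is P ∩ K[X_1,…,X_ℓ].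

One inclusion is substitution of b, with nonzero coordinates, for the last variables
(`specialize_mem_saturation`). For the other, K[X]/P is algebraic over the polynomial ring in the
outer variables X_1,…,X_t, X_{t+r+1},…,X_n. For generic b the prime generated there by the X_i - b_i
with i > t+r therefore lifts to a prime Q ⊇ P avoiding X_1⋯X_n, modulo which X_1,…,X_t stay
independent (`exists_ne_zero_forall_exists_prime`). Any g in the specialized saturation lies in Q.
If g were not in P, some multiple of it would be congruent modulo P to a nonzero polynomial in
X_1,…,X_t, and that polynomial would lie in Q (`comap_saturation_le_of_prime`). The single prime Q
suffices: nothing need be known about the specialized ideal itself. -/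

theorem exists_ne_zero_forall_isIntegral_pow_smul (S B : Type*) [CommRing S] [IsDomain S]
    [CommRing B] [Algebra S B] [Algebra.FiniteType S B] [Algebra.IsAlgebraic S B] :
    ∃ a : S, a ≠ 0 ∧ ∀ b : B, ∃ N : ℕ, IsIntegral S (a ^ N • b) := by
  obtain ⟨s, hs⟩ := (Algebra.FiniteType.out : (⊤ : Subalgebra S B).FG)
  -- `a` is a common denominator for the finitely many generators; the power needed grows with
  -- products.
  obtain ⟨a, ha, hint⟩ := Algebra.IsAlgebraic.exists_integral_multiples S s
  refine ⟨a, ha, fun b => ?_⟩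
  have hb : b ∈ Algebra.adjoin S (s : Set B) := hs ▸ Algebra.mem_top
  induction hb using Algebra.adjoin_induction with
  | mem x hx => exact ⟨1, by simpa using hint x hx⟩
  | algebraMap c => exact ⟨0, by simpa using isIntegral_algebraMap⟩
  | add x y _ _ hx hy =>
    obtain ⟨N, hN⟩ := hx
    obtain ⟨N', hN'⟩ := hy
    refine ⟨N + N', ?_⟩
    have e : a ^ (N + N') • (x + y) = a ^ N' • (a ^ N • x) + a ^ N • (a ^ N' • y) := by
      rw [smul_add, smul_smul, smul_smul, pow_add, mul_comm]
    rw [e]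
    exact (hN.smul _).add (hN'.smul _)
  | mul x y _ _ hx hy =>
    obtain ⟨N, hN⟩ := hx
    obtain ⟨N', hN'⟩ := hy
    refine ⟨N + N', ?_⟩
    have e : a ^ (N + N') • (x * y) = (a ^ N • x) * (a ^ N' • y) := by
      rw [smul_mul_smul_comm, pow_add]
    exact e ▸ hN.mul (hN' : _)

/-- If `B` is an algebraic domain of finite type over `S` and `u ≠ 0` in `B`, then the primes of
`S` in a nonempty basic open set lift to primes of `B` that do not contain `u`. -/
theorem exists_ne_zero_forall_prime_lift (S B : Type*) [CommRing S] [IsDomain S]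
    [CommRing B] [IsDomain B] [Algebra S B] [FaithfulSMul S B] [Algebra.FiniteType S B]
    [Algebra.IsAlgebraic S B] (u : B) (hu : u ≠ 0) :
    ∃ a : S, a ≠ 0 ∧ ∀ q : Ideal S, q.IsPrime → a ∉ q →
      ∃ Q : Ideal B, Q.IsPrime ∧ Q.comap (algebraMap S B) = q ∧ u ∉ Q := by
  -- Inverting `a` makes `B` integral over `S`, which gives lying over; `c` is a nonzero multiple of
  -- `u` in `S`, so a prime avoiding `c` avoids `u`.
  obtain ⟨a, ha, hint⟩ := exists_ne_zero_forall_isIntegral_pow_smul S B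
  obtain ⟨c, hc, huc⟩ := (Algebra.IsAlgebraic.isAlgebraic (R := S) u).exists_nonzero_dvd
    (mem_nonZeroDivisors_of_ne_zero hu)
  refine ⟨a * c, mul_ne_zero ha hc, fun q hq hacq => ?_⟩
  have haq : a ∉ q := fun h => hacq (q.mul_mem_right _ h)
  have hcq : c ∉ q := fun h => hacq (q.mul_mem_left _ h)
  obtain ⟨Q₀, hQ₀, hQ₀q⟩ := Ideal.exists_ideal_over_prime_of_isIntegral_of_isDomain
    (S := integralClosure S B) q (by
      rw [(RingHom.injective_iff_ker_eq_bot _).mp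
        (FaithfulSMul.algebraMap_injective S (integralClosure S B))]
      exact bot_le)
  have haQ₀ : algebraMap S (integralClosure S B) a ∉ Q₀ := fun h => haq (hQ₀q ▸ h)
  -- A power of `a` brings the extended ideal back into `Q₀`. Since `a ∉ Q₀`, `Q₀` is the
  -- contraction of its extension, hence of a prime of `B`.
  have key : ∀ b ∈ Q₀.map (algebraMap (integralClosure S B) B),
      ∃ N : ℕ, ∃ z ∈ Q₀, a ^ N • b = algebraMap (integralClosure S B) B z := by
    intro b hb
    induction hb using Submodule.span_induction with
    | mem x hx =>
      obtain ⟨z, hz, rfl⟩ := hx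
      exact ⟨0, z, hz, by simp⟩
    | zero => exact ⟨0, 0, Q₀.zero_mem, by simp⟩
    | add x y _ _ hx hy =>
      obtain ⟨N, z, hz, e⟩ := hx
      obtain ⟨N', z', hz', e'⟩ := hy
      refine ⟨N + N', a ^ N' • z + a ^ N • z',
        Q₀.add_mem (Submodule.smul_of_tower_mem _ _ hz) (Submodule.smul_of_tower_mem _ _ hz'), ?_⟩
      change _ = a ^ N' • algebraMap (integralClosure S B) B z +
        a ^ N • algebraMap (integralClosure S B) B z'
      rw [← e, ← e', smul_add, smul_smul, smul_smul, ← pow_add, ← pow_add, add_comm N' N]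
    | smul y x _ hx =>
      obtain ⟨N, z, hz, e⟩ := hx
      obtain ⟨N', hN'⟩ := hint y
      refine ⟨N' + N, ⟨a ^ N' • y, hN'⟩ * z, Q₀.mul_mem_left _ hz, ?_⟩
      rw [map_mul, ← e, smul_eq_mul, pow_add, ← smul_mul_smul_comm]
      rfl
  have hcomap : (Q₀.map (algebraMap (integralClosure S B) B)).comap
      (algebraMap (integralClosure S B) B) = Q₀ := by
    refine le_antisymm (fun z hz => ?_) Ideal.le_comap_map
    obtain ⟨N, w, hw, e⟩ := key _ hz
    have e' : algebraMap S (integralClosure S B) a ^ N * z = w := by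
      apply FaithfulSMul.algebraMap_injective (integralClosure S B) B
      rw [← e, ← map_pow, ← Algebra.smul_def]
      rfl
    exact (hQ₀.mem_or_mem (e' ▸ hw)).resolve_left fun h => haQ₀ (hQ₀.mem_of_pow_mem _ h)
  obtain ⟨⟨Q, hQ⟩, hQQ₀⟩ := (PrimeSpectrum.mem_range_comap_iff
    (algebraMap (integralClosure S B) B) (p := ⟨Q₀, hQ₀⟩)).mpr hcomap
  have hQQ₀' : Q.comap (algebraMap (integralClosure S B) B) = Q₀ :=
    congrArg PrimeSpectrum.asIdeal hQQ₀
  have hQq : Q.comap (algebraMap S B) = q := by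
    rw [← hQ₀q, ← hQQ₀', Ideal.comap_comap, ← IsScalarTower.algebraMap_eq]
  refine ⟨Q, hQ, hQq, fun h => hcq ?_⟩
  rw [← hQq]
  exact Q.mem_of_dvd huc h

end Lifting

/-! ### Transcendence bases consisting of coordinate functions -/

section CoordinateRing

variable {σ ι K : Type*} [Field K]

theorem isTranscendenceBasis_mk_of_fractionRing {P : Ideal (MvPolynomial σ K)} {c : ι → σ}
    (h : IsTranscendenceBasis K fun i =>
      algebraMap (MvPolynomial σ K ⧸ P) (FractionRing (MvPolynomial σ K ⧸ P))
        (Ideal.Quotient.mk P (X (c i)))) :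
    IsTranscendenceBasis K fun i => Ideal.Quotient.mk P (X (c i)) :=
  .of_comp (IsScalarTower.toAlgHom K (MvPolynomial σ K ⧸ P) _)
    (IsFractionRing.injective _ _) h

theorem aeval_mk_X_comp (P : Ideal (MvPolynomial σ K)) (c : ι → σ) (p : MvPolynomial ι K) :
    aeval (fun i => Ideal.Quotient.mk P (X (c i))) p = Ideal.Quotient.mk P (rename c p) := by
  have : (aeval fun i => Ideal.Quotient.mk P (X (c i))) =
      (Ideal.Quotient.mkₐ K P).comp (rename c) := by
    ext i; simp
  rw [this]; rfl

theorem algebraicIndependent_mk_iff {P : Ideal (MvPolynomial σ K)} {c : ι → σ} :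
    (AlgebraicIndependent K fun i => Ideal.Quotient.mk P (X (c i))) ↔
      ∀ p : MvPolynomial ι K, rename c p ∈ P → p = 0 := by
  rw [algebraicIndependent_iff]
  simp_rw [aeval_mk_X_comp, Ideal.Quotient.eq_zero_iff_mem]

/-- In a domain, a nonzero algebraic element divides a nonzero element of the base: the constant
term of a relation of least degree. -/
theorem exists_mul_sub_rename_mem {P : Ideal (MvPolynomial σ K)} [P.IsPrime] {c : ι → σ}
    (h : IsTranscendenceBasis K fun i => Ideal.Quotient.mk P (X (c i)))
    {g : MvPolynomial σ K} (hg : g ∉ P) :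
    ∃ p : MvPolynomial ι K, p ≠ 0 ∧ ∃ q, g * q - rename c p ∈ P := by
  obtain ⟨⟨r, hr⟩, hr0, y, hy⟩ := (h.isAlgebraic.1 (Ideal.Quotient.mk P g)).exists_nonzero_dvd
      (mem_nonZeroDivisors_of_ne_zero (by rwa [Ne, Ideal.Quotient.eq_zero_iff_mem]))
  have hr' := hr
  rw [Algebra.adjoin_range_eq_range_aeval] at hr'
  obtain ⟨p, hp⟩ := hr'
  obtain ⟨q, rfl⟩ := Ideal.Quotient.mk_surjective y
  refine ⟨p, ?_, q, ?_⟩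
  · rintro rfl
    exact hr0 (Subtype.ext (by simpa using hp.symm))
  · rw [← Ideal.Quotient.eq, map_mul, ← hy, ← aeval_mk_X_comp]
    exact hp.symm

/-- A generic specialization of a transcendence basis consisting of coordinates extends to a prime
ideal of the coordinate ring, avoiding a given nonzero function. -/
theorem exists_ne_zero_forall_exists_prime [Finite σ] {P : Ideal (MvPolynomial σ K)} [P.IsPrime]
    {c : ι → σ} (h : IsTranscendenceBasis K fun i => Ideal.Quotient.mk P (X (c i)))
    {u : MvPolynomial σ K} (hu : u ∉ P) :
    ∃ a : MvPolynomial ι K, a ≠ 0 ∧ ∀ {D : Type*} [CommRing D] [IsDomain D] [Algebra K D]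
      (f : MvPolynomial ι K →ₐ[K] D), f a ≠ 0 →
      ∃ Q : Ideal (MvPolynomial σ K), Q.IsPrime ∧ P ≤ Q ∧ u ∉ Q ∧
        ∀ p, rename c p ∈ Q ↔ f p = 0 := by
  have := h.isAlgebraic
  let S := Algebra.adjoin K (Set.range fun i => Ideal.Quotient.mk P (X (c i)))
  let e : MvPolynomial ι K ≃ₐ[K] S := h.1.aevalEquiv
  have he : ∀ p, ((e p : S) : MvPolynomial σ K ⧸ P) = Ideal.Quotient.mk P (rename c p) := by
    intro p
    rw [← aeval_mk_X_comp]
    exact h.1.algebraMap_aevalEquiv p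
  have : Algebra.FiniteType S (MvPolynomial σ K ⧸ P) :=
    Algebra.FiniteType.of_restrictScalars_finiteType K S _
  obtain ⟨a, ha, H⟩ := exists_ne_zero_forall_prime_lift S (MvPolynomial σ K ⧸ P)
    (Ideal.Quotient.mk P u) (by rwa [Ne, Ideal.Quotient.eq_zero_iff_mem])
  refine ⟨e.symm a, by simpa using ha, fun {D} _ _ _ f hf => ?_⟩
  -- By independence `S` is a polynomial ring, so `f` transports to `S`; its kernel there is the
  -- prime to lift.
  obtain ⟨Q, hQ, hQq, huQ⟩ := H (RingHom.ker (f.comp e.symm.toAlgHom)) (RingHom.ker_isPrime _)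
    (by simpa [RingHom.mem_ker] using hf)
  refine ⟨Q.comap (Ideal.Quotient.mk P), hQ.comap _, ?_, huQ, fun p => ?_⟩
  · intro x hx
    rw [Ideal.mem_comap, Ideal.Quotient.eq_zero_iff_mem.mpr hx]
    exact Q.zero_mem
  · have : rename c p ∈ Q.comap (Ideal.Quotient.mk P) ↔
        e p ∈ Q.comap (algebraMap S (MvPolynomial σ K ⧸ P)) := by
      rw [Ideal.mem_comap, ← he]; rfl
    rw [this, hQq, RingHom.mem_ker]
    simp

end CoordinateRing

/-! ### Generic systems -/

section GenericSystem

theorem monomial_one_dvd_prod_X_pow {σ R : Type*} [CommRing R] [Fintype σ] (a : σ →₀ ℕ) :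
    (monomial a (1 : R)) ∣ (∏ i, X i) ^ (∑ i, a i) := by
  rw [monomial_eq, C_1, one_mul, Finsupp.prod_fintype _ _ (by simp), ← Finset.prod_pow_eq_pow_sum]
  exact Finset.prod_dvd_prod_of_dvd _ _ fun i hi =>
    pow_dvd_pow_of_dvd (Finset.dvd_prod_of_mem _ hi) _

variable {n r : ℕ} (A : Fin r → Finset (Fin n →₀ ℕ))

/-- The ring of polynomials with coefficients in `ℚ[C_{j,a}]`. -/
abbrev IntegralRing : Type := MvPolynomial (Fin n) (MvPolynomial (CoeffIndex A) ℚ)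

/-- The embedding of `ℚ[C_{j,a}][X]` into its field of fractions. -/
noncomputable abbrev toFractions : IntegralRing A →+* FractionRing (IntegralRing A) :=
  algebraMap (IntegralRing A) (FractionRing (IntegralRing A))

/-- The generic polynomial with coefficients in the polynomial ring `ℚ[C_{j,a}]`. -/
noncomputable def integralGenericPoly (j : Fin r) :
    IntegralRing A :=
  ∑ a : {a : Fin n →₀ ℕ // a ∈ A j}, monomial a.1 (X (⟨j, a⟩ : CoeffIndex A))

theorem map_integralGenericPoly (j : Fin r) :
    map (algebraMap (MvPolynomial (CoeffIndex A) ℚ) (CoeffField A)) (integralGenericPoly A j) =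
      genericPoly A j := by
  simp [integralGenericPoly, genericPoly]

variable {A} (a₀ : ∀ j, {a : Fin n →₀ ℕ // a ∈ A j})

open Classical in
/-- The substitution solving the equation `f_j = 0` for the coefficient of index `(j, a₀ j)`. -/
noncomputable def solveSubst :
    IntegralRing A →+* FractionRing (IntegralRing A) :=
  eval₂Hom
    (eval₂Hom (algebraMap ℚ _) fun i : CoeffIndex A =>
      toFractions A (C (X i)) - if i.2 = a₀ i.1 then
        toFractions A (integralGenericPoly A i.1) / toFractions A (monomial i.2.1 1) else 0)
    fun i => toFractions A (X i)

theorem solveSubst_X (i : Fin n) : solveSubst a₀ (X i) = toFractions A (X i) :=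
  eval₂_X _ _ _

theorem solveSubst_prod_X : solveSubst a₀ (∏ i, X i) = toFractions A (∏ i, X i) := by
  simp [solveSubst_X]

theorem solveSubst_monomial_one (a : Fin n →₀ ℕ) :
    solveSubst a₀ (monomial a 1) = toFractions A (monomial a 1) := by
  rw [monomial_eq, C_1, one_mul, Finsupp.prod]
  simp only [map_prod, map_pow, solveSubst_X]

theorem algebraMap_monomial_one_ne_zero (a : Fin n →₀ ℕ) :
    toFractions A (monomial a 1) ≠ 0 := by
  simp

/-- Subtracting f_j / X^a from the coefficient of X^a, for a = `a₀ j`, subtracts exactly f_j from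
f_j. -/
theorem solveSubst_integralGenericPoly (j : Fin r) :
    solveSubst a₀ (integralGenericPoly A j) = 0 := by
  classical
  have h : ∀ a : {a : Fin n →₀ ℕ // a ∈ A j},
      solveSubst a₀ (monomial a.1 (X (⟨j, a⟩ : CoeffIndex A))) =
        toFractions A (monomial a.1 (X (⟨j, a⟩ : CoeffIndex A))) -
          if a = a₀ j then toFractions A (integralGenericPoly A j) else 0 := by
    intro a
    have e : monomial a.1 (X (⟨j, a⟩ : CoeffIndex A)) =
        (monomial a.1 (1 : MvPolynomial (CoeffIndex A) ℚ)) * C (X ⟨j, a⟩) := by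
      rw [mul_comm, C_mul_monomial, mul_one]
    have hC : solveSubst a₀ (C (X (⟨j, a⟩ : CoeffIndex A))) =
        toFractions A (C (X (⟨j, a⟩ : CoeffIndex A))) - if a = a₀ j then
          toFractions A (integralGenericPoly A j) / toFractions A (monomial a.1 1) else 0 := by
      simp [solveSubst]
    rw [e, map_mul, map_mul, solveSubst_monomial_one, hC, mul_sub]
    congr 1
    split_ifs
    · rw [mul_div_cancel₀ _ (algebraMap_monomial_one_ne_zero _)]
    · rw [mul_zero]
  rw [integralGenericPoly, map_sum, Finset.sum_congr rfl fun a _ => h a, Finset.sum_sub_distrib,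
    ← map_sum, ← integralGenericPoly]
  simp

/-- Up to powers of the variables, the substitution is the identity modulo the generic system. -/
theorem exists_pow_mul_solveSubst
    (g : IntegralRing A) :
    ∃ N : ℕ, ∃ h ∈ Ideal.span (Set.range (integralGenericPoly A)),
      toFractions A ((∏ i, X i) ^ N) * solveSubst a₀ g =
        toFractions A ((∏ i, X i) ^ N * g + h) := by
  classical
  set I := Ideal.span (Set.range (integralGenericPoly A))
  -- The property is stable under sums and products, so it need only be checked on generators; the
  -- sole nontrivial ones are the coefficients of index `a₀ j`.
  have add : ∀ g g' : IntegralRing A,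
      (∃ N : ℕ, ∃ h ∈ I, toFractions A ((∏ i, X i) ^ N) * solveSubst a₀ g =
        toFractions A ((∏ i, X i) ^ N * g + h)) →
      (∃ N : ℕ, ∃ h ∈ I, toFractions A ((∏ i, X i) ^ N) * solveSubst a₀ g' =
        toFractions A ((∏ i, X i) ^ N * g' + h)) →
      ∃ N : ℕ, ∃ h ∈ I, toFractions A ((∏ i, X i) ^ N) * solveSubst a₀ (g + g') =
        toFractions A ((∏ i, X i) ^ N * (g + g') + h) := by
    rintro g g' ⟨N, h, hI, e⟩ ⟨N', h', hI', e'⟩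
    refine ⟨N + N', (∏ i, X i) ^ N' * h + (∏ i, X i) ^ N * h',
      I.add_mem (I.mul_mem_left _ hI) (I.mul_mem_left _ hI'), ?_⟩
    simp only [map_add, map_mul, map_pow, pow_add] at e e' ⊢
    linear_combination (toFractions A (∏ i, X i)) ^ N' * e +
      (toFractions A (∏ i, X i)) ^ N * e'
  have mul : ∀ g g' : IntegralRing A,
      (∃ N : ℕ, ∃ h ∈ I, toFractions A ((∏ i, X i) ^ N) * solveSubst a₀ g =
        toFractions A ((∏ i, X i) ^ N * g + h)) →
      (∃ N : ℕ, ∃ h ∈ I, toFractions A ((∏ i, X i) ^ N) * solveSubst a₀ g' =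
        toFractions A ((∏ i, X i) ^ N * g' + h)) →
      ∃ N : ℕ, ∃ h ∈ I, toFractions A ((∏ i, X i) ^ N) * solveSubst a₀ (g * g') =
        toFractions A ((∏ i, X i) ^ N * (g * g') + h) := by
    rintro g g' ⟨N, h, hI, e⟩ ⟨N', h', hI', e'⟩
    refine ⟨N + N', (∏ i, X i) ^ N * g * h' + ((∏ i, X i) ^ N' * g' + h') * h,
      I.add_mem (I.mul_mem_left _ hI') (I.mul_mem_left _ hI), ?_⟩
    rw [map_mul (solveSubst a₀), pow_add, map_mul, mul_mul_mul_comm, e, e', ← map_mul]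
    congr 1
    ring
  induction g using MvPolynomial.induction_on with
  | C c =>
    induction c using MvPolynomial.induction_on with
    | C q =>
      refine ⟨0, 0, I.zero_mem, ?_⟩
      have : solveSubst a₀ (C (C q)) = toFractions A (C (C q)) := by
        simp only [solveSubst, coe_eval₂Hom, eval₂_C]
        exact (RingHom.congr_fun (RingHom.ext_rat _ _) q :
          _ = ((toFractions A).comp (C.comp C)) q)
      simp [this]
    | add p q hp hq => rw [C_add]; exact add _ _ hp hq
    | mul_X p i hp =>
      rw [C_mul]
      refine mul _ _ hp ?_
      have hC : solveSubst a₀ (C (X i)) = toFractions A (C (X i)) - if i.2 = a₀ i.1 then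
          toFractions A (integralGenericPoly A i.1) / toFractions A (monomial i.2.1 1)
          else 0 := by
        simp [solveSubst]
      rw [hC]
      split_ifs
      · obtain ⟨d, hd⟩ := monomial_one_dvd_prod_X_pow (R := MvPolynomial (CoeffIndex A) ℚ) i.2.1
        refine ⟨∑ j, i.2.1 j, -(d * integralGenericPoly A i.1),
          I.neg_mem (I.mul_mem_left _ (Ideal.subset_span ⟨_, rfl⟩)), ?_⟩
        rw [hd]
        simp only [map_add, map_mul, map_neg]
        have := algebraMap_monomial_one_ne_zero (A := A) i.2.1
        field_simp
        ring
      · exact ⟨0, 0, I.zero_mem, by simp⟩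
  | add p q hp hq => exact add _ _ hp hq
  | mul_X p i hp => exact mul _ _ hp ⟨0, 0, I.zero_mem, by simp [solveSubst_X]⟩

/-- The saturation over ℚ[C] is thus the kernel of a map to a field, hence prime. -/
theorem solveSubst_eq_zero_iff {g : IntegralRing A} :
    solveSubst a₀ g = 0 ↔
      ∃ N : ℕ, (∏ i, X i) ^ N * g ∈ Ideal.span (Set.range (integralGenericPoly A)) := by
  constructor
  · intro h
    obtain ⟨N, p, hp, e⟩ := exists_pow_mul_solveSubst a₀ g
    refine ⟨N, ?_⟩
    rw [h, mul_zero, eq_comm, IsFractionRing.to_map_eq_zero_iff] at e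
    rw [eq_neg_of_add_eq_zero_left e]
    exact neg_mem hp
  · rintro ⟨N, hN⟩
    have hle : Ideal.span (Set.range (integralGenericPoly A)) ≤ RingHom.ker (solveSubst a₀) := by
      rw [Ideal.span_le]
      rintro _ ⟨j, rfl⟩
      exact solveSubst_integralGenericPoly a₀ j
    have h := hle hN
    rw [RingHom.mem_ker, map_mul, map_pow, solveSubst_prod_X] at h
    refine (mul_eq_zero.mp h).resolve_left (pow_ne_zero _ ?_)
    rw [Ne, IsFractionRing.to_map_eq_zero_iff]
    exact Finset.prod_ne_zero_iff.mpr fun i _ => X_ne_zero i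

/-- The saturation of the ideal of a generic system is prime, unless it is the unit ideal. -/
theorem isPrime_saturation_genericPoly (hA : ∀ j, (A j).Nonempty)
    (h : saturation (Ideal.span (Set.range (genericPoly A))) (∏ i, X i) ≠ ⊤) :
    (saturation (Ideal.span (Set.range (genericPoly A))) (∏ i, X i)).IsPrime := by
  let a₀ : ∀ j, {a : Fin n →₀ ℕ // a ∈ A j} := fun j => ⟨(hA j).choose, (hA j).choose_spec⟩
  let Z := nonZeroDivisors (MvPolynomial (CoeffIndex A) ℚ)
  let _ : Algebra (MvPolynomial (Fin n) (MvPolynomial (CoeffIndex A) ℚ))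
      (MvPolynomial (Fin n) (CoeffField A)) := algebraMvPolynomial
  have hloc : IsLocalization (Z.map (C (σ := Fin n))) (MvPolynomial (Fin n) (CoeffField A)) :=
    MvPolynomial.isLocalization Z (CoeffField A)
  have hmap : ∀ p, algebraMap (MvPolynomial (Fin n) (MvPolynomial (CoeffIndex A) ℚ))
      (MvPolynomial (Fin n) (CoeffField A)) p = map (algebraMap _ _) p := fun p => rfl
  have hspan : (Ideal.span (Set.range (integralGenericPoly A))).map (algebraMap _ _) =
      Ideal.span (Set.range (genericPoly A)) := by
    rw [Ideal.map_span, ← Set.range_comp]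
    congr 2
    exact funext fun j => map_integralGenericPoly A j
  have hX : algebraMap (MvPolynomial (Fin n) (MvPolynomial (CoeffIndex A) ℚ))
      (MvPolynomial (Fin n) (CoeffField A)) (∏ i, X i) = ∏ i, X i := by
    simp
  let P₀ := RingHom.ker (solveSubst a₀)
  have hP₀ : P₀.IsPrime := RingHom.ker_isPrime _
  have hle : P₀.map (algebraMap _ _) ≤
      saturation (Ideal.span (Set.range (genericPoly A))) (∏ i, X i) := by
    rw [Ideal.map_le_iff_le_comap]
    intro g hg
    obtain ⟨N, hN⟩ := (solveSubst_eq_zero_iff a₀).mp hg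
    refine ⟨N, ?_⟩
    rw [← hspan, ← hX, ← map_pow, ← map_mul]
    exact Ideal.mem_map_of_mem _ hN
  -- Passing from ℚ[C] to K is a localization; `P₀` survives it, since a nonzero constant in `P₀`
  -- would make the saturation the unit ideal.
  have hdisj : Disjoint (Z.map (C (σ := Fin n)) : Set _)
      (P₀ : Set (MvPolynomial (Fin n) (MvPolynomial (CoeffIndex A) ℚ))) := by
    rw [Set.disjoint_left]
    intro z hz hzP
    exact h (Ideal.eq_top_of_isUnit_mem _ (hle (Ideal.mem_map_of_mem _ hzP))
      (IsLocalization.map_units _ ⟨z, hz⟩))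
  have hprime := IsLocalization.isPrime_of_isPrime_disjoint (Z.map (C (σ := Fin n)))
    (MvPolynomial (Fin n) (CoeffField A)) P₀ hP₀ hdisj
  have hXP : (∏ i, X i) ∉ P₀.map (algebraMap _ (MvPolynomial (Fin n) (CoeffField A))) := by
    intro hX'
    obtain ⟨N, hN⟩ := hle hX'
    refine h ((Ideal.eq_top_iff_one _).mpr ⟨N + 1, ?_⟩)
    rwa [mul_one, pow_succ]
  have hfP : Ideal.span (Set.range (genericPoly A)) ≤ P₀.map (algebraMap _ _) := by
    rw [← hspan]
    refine Ideal.map_mono (Ideal.span_le.mpr ?_)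
    rintro _ ⟨j, rfl⟩
    exact solveSubst_integralGenericPoly a₀ j
  convert! hprime
  refine le_antisymm ?_ hle
  rintro g ⟨N, hN⟩
  exact (hprime.mem_or_mem (hfP hN)).resolve_left fun h => hXP (hprime.mem_of_pow_mem _ h)

end GenericSystem

/-! ### Vanishing ideals -/

section VanishingIdeals

variable {σ k L : Type*} [Field k] [Field L] [Algebra k L]

theorem vanishingIdeal_zariskiClosure (S : Set (σ → L)) :
    vanishingIdeal k (zariskiClosure S) = vanishingIdeal k S := by
  refine le_antisymm (vanishingIdeal_anti_mono (zeroLocus_vanishingIdeal_le S)) fun p hp x hx => ?_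
  rw [← aeval_map_algebraMap L]
  exact hx _ fun y hy => by rw [aeval_map_algebraMap]; exact hp y hy

theorem vanishingIdeal_proj_image {l n : ℕ} (h : l ≤ n) (V : Set (Fin n → L)) :
    vanishingIdeal k (proj L h '' V) = (vanishingIdeal k V).comap (rename (Fin.castLE h)) := by
  ext p
  simp only [Ideal.mem_comap, mem_vanishingIdeal_iff, Set.forall_mem_image, aeval_rename]
  rfl

/-- If g vanishes at the torus zeros, (∏ X_i) g vanishes at all zeros, so a power of it lies in the
ideal; primality of the saturation removes the exponent on g. -/
theorem vanishingIdeal_Vstar [IsAlgClosed L] [Fintype σ] {r : ℕ} (f : Fin r → MvPolynomial σ k)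
    (h : saturation (Ideal.span (Set.range f)) (∏ i, X i) ≠ ⊤ →
      (saturation (Ideal.span (Set.range f)) (∏ i, X i)).IsPrime) :
    vanishingIdeal k (Vstar L f) = saturation (Ideal.span (Set.range f)) (∏ i, X i) := by
  rw [Vstar, vanishingIdeal_zariskiClosure]
  have hspan : zeroLocus L (Ideal.span (Set.range f)) = {x | ∀ j, aeval x (f j) = 0} := by
    rw [zeroLocus_span]; simp
  refine le_antisymm (fun g hg => ?_) ?_
  · by_cases htop : saturation (Ideal.span (Set.range f)) (∏ i, X i) = ⊤
    · rw [htop]; trivial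
    have hp := h htop
    have hrad : (∏ i, X i) * g ∈ (Ideal.span (Set.range f)).radical := by
      rw [← vanishingIdeal_zeroLocus_eq_radical (K := L), hspan]
      intro x hx
      rw [map_mul, mul_eq_zero, map_prod]
      simp only [aeval_X]
      by_cases hx0 : ∀ i, x i ≠ 0
      · exact Or.inr (hg x ⟨hx, hx0⟩)
      · push Not at hx0
        obtain ⟨i, hi⟩ := hx0
        exact Or.inl (Finset.prod_eq_zero (Finset.mem_univ i) hi)
    obtain ⟨N, hN⟩ := hrad
    refine hp.mem_of_pow_mem N ⟨N, ?_⟩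
    rwa [← mul_pow]
  · rintro g ⟨N, hN⟩ x ⟨hx, hx0⟩
    have h0 : aeval x ((∏ i, X i) ^ N * g) = 0 := by
      have hx' : x ∈ zeroLocus L (Ideal.span (Set.range f)) := hspan ▸ hx
      exact hx' _ hN
    rw [map_mul, map_pow, map_prod] at h0
    simp only [aeval_X] at h0
    exact (mul_eq_zero.mp h0).resolve_left
      (pow_ne_zero _ (Finset.prod_ne_zero_iff.mpr fun i _ => hx0 i))

end VanishingIdeals

/-! ### Generic specializations -/

section Specialization

theorem isZariskiOpen_setOf_aeval_ne_zero {σ L : Type*} [Field L] (w : MvPolynomial σ L) :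
    IsZariskiOpen {x : σ → L | aeval x w ≠ 0} :=
  ⟨Ideal.span {w}, by rw [zeroLocus_span]; ext x; simp⟩

theorem isZariskiDense_setOf_aeval_ne_zero {σ L : Type*} [Field L] [Infinite L]
    {w : MvPolynomial σ L} (hw : w ≠ 0) : IsZariskiDense {x : σ → L | aeval x w ≠ 0} := by
  refine Set.eq_univ_of_forall fun x p hp => ?_
  have h0 : p * w = 0 := by
    refine MvPolynomial.funext fun y => ?_
    rw [map_mul, map_zero]
    by_cases hy : aeval y w = 0
    · exact mul_eq_zero_of_right _ (by simpa [aeval_def] using hy)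
    · exact mul_eq_zero_of_left (by simpa [aeval_def] using hp y hy) _
  rw [(mul_eq_zero.mp h0).resolve_right hw, map_zero]

variable {K : Type*} [Field K] {n r t l : ℕ}

/-- The indices of the first `t` and of the last `n - s` coordinates. -/
abbrev OuterIndex (n t s : ℕ) : Type := {i : Fin n // (i : ℕ) < t ∨ s ≤ (i : ℕ)}

/-- Otherwise X_{t+r+1} is a coordinate of the projection, and together with X_1,…,X_t it gives t+1
independent functions where the transcendence degree is t. -/
theorem le_add_of_isTranscendenceBasis (hr : 0 < r) (hln : l ≤ n) (htl : t ≤ l)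
    {P : Ideal (MvPolynomial (Fin n) K)} [P.IsPrime]
    (hbase : IsTranscendenceBasis K fun i : Fin t =>
      Ideal.Quotient.mk (P.comap (rename (Fin.castLE hln) :
        MvPolynomial (Fin l) K →ₐ[K] MvPolynomial (Fin n) K)) (X (Fin.castLE htl i)))
    (htop : AlgebraicIndependent K fun i : OuterIndex n t (t + r) =>
      Ideal.Quotient.mk P (X i.1)) :
    l ≤ t + r := by
  by_contra! hlt
  let c : Option (Fin t) → Fin l := fun o => o.elim ⟨t + r, hlt⟩ (Fin.castLE htl)
  let d : Option (Fin t) → OuterIndex n t (t + r) := fun o =>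
    o.elim ⟨⟨t + r, by omega⟩, Or.inr le_rfl⟩ fun i => ⟨⟨i, by omega⟩, Or.inl i.2⟩
  have hd : Function.Injective d := by
    rintro (_ | i) (_ | j) h
    · rfl
    · have := congrArg (fun u : OuterIndex n t (t + r) => (u.1 : ℕ)) h
      simp only [d, Option.elim] at this
      omega
    · have := congrArg (fun u : OuterIndex n t (t + r) => (u.1 : ℕ)) h
      simp only [d, Option.elim] at this
      omega
    · have := congrArg (fun u : OuterIndex n t (t + r) => (u.1 : ℕ)) h
      simp only [d, Option.elim] at this
      rw [Fin.ext this]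
  have hcd : Fin.castLE hln ∘ c = Subtype.val ∘ d := by
    funext o; cases o <;> rfl
  have hind : AlgebraicIndependent K fun o => Ideal.Quotient.mk (P.comap (rename (Fin.castLE hln) :
      MvPolynomial (Fin l) K →ₐ[K] MvPolynomial (Fin n) K)) (X (c o)) := by
    rw [algebraicIndependent_mk_iff] at htop ⊢
    intro p hp
    rw [Ideal.mem_comap, rename_rename, hcd, ← rename_rename] at hp
    exact (map_eq_zero_iff _ (rename_injective d hd)).mp (htop _ hp)
  have h1 := hind.lift_cardinalMk_le_trdeg
  have h2 := hbase.lift_cardinalMk_eq_trdeg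
  simp only [Cardinal.mk_fintype, Fintype.card_option, Fintype.card_fin, Cardinal.lift_natCast,
    Cardinal.lift_uzero] at h1 h2
  rw [← h2] at h1
  have := Nat.cast_le.mp h1
  omega

/-- The restriction of a specialization of the last `n - s` coordinates to the polynomials in the
outer variables. -/
noncomputable def specializeOuter (n t s : ℕ) (b : Fin (n - s) → K) :
    MvPolynomial (OuterIndex n t s) K →ₐ[K] MvPolynomial (Fin t) K :=
  aeval fun i => if h : (i.1 : ℕ) < t then X ⟨i.1, h⟩ else C (b ⟨i.1 - s, by omega⟩)

/-- A nonzero polynomial in the outer variables stays nonzero under generic specializations. -/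
theorem exists_ne_zero_forall_specializeOuter_ne_zero [Infinite K] {s : ℕ} (hts : t ≤ s)
    (hsn : s ≤ n)
    {a : MvPolynomial (OuterIndex n t s) K} (ha : a ≠ 0) :
    ∃ w : MvPolynomial (Fin (n - s)) K, w ≠ 0 ∧
      ∀ b : Fin (n - s) → K, aeval b w ≠ 0 → specializeOuter n t s b a ≠ 0 := by
  obtain ⟨u, hu⟩ : ∃ u : OuterIndex n t s → K, aeval u a ≠ 0 := by
    by_contra! h
    exact ha (MvPolynomial.funext fun u => by simpa [aeval_def] using h u)
  -- Freeze the first t variables at a point where `a` is nonzero; `w` is what remains as a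
  -- polynomial in b.
  let τ : Fin t → K := fun i => u ⟨⟨i, by omega⟩, Or.inl i.2⟩
  let w : MvPolynomial (Fin (n - s)) K :=
    aeval (fun i : OuterIndex n t s =>
      if h : (i.1 : ℕ) < t then C (τ ⟨i.1, h⟩) else X ⟨i.1 - s, by omega⟩) a
  have hw : ∀ b : Fin (n - s) → K, aeval b w = aeval τ (specializeOuter n t s b a) := by
    intro b
    rw [← AlgHom.comp_apply, specializeOuter, ← AlgHom.comp_apply, comp_aeval, comp_aeval]
    congr 2
    funext i
    split_ifs <;> simp [aeval_def]
  have hwu : aeval (fun i : Fin (n - s) => u ⟨⟨s + i, by omega⟩, Or.inr (Nat.le_add_right _ _)⟩) w =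
      aeval u a := by
    rw [← AlgHom.comp_apply, comp_aeval]
    congr 2
    funext i
    split_ifs with h
    · simp [τ]
    · rw [aeval_X]
      congr 2
      have := i.2.resolve_left h
      exact Fin.ext (by simp; omega)
  refine ⟨w, ?_, fun b hb h => hb ?_⟩
  · intro h
    rw [h, map_zero] at hwu
    exact hu hwu.symm
  · rw [hw, h, map_zero]

theorem specialize_rename_castLE {s : ℕ} (hls : l ≤ s) (hln : l ≤ n) (b : Fin (n - s) → K)
    (g : MvPolynomial (Fin l) K) :
    specialize n s b (rename (Fin.castLE hln) g) = rename (Fin.castLE hls) g := by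
  rw [specialize, aeval_rename, rename_eq_aeval]
  congr 2
  funext i
  have h : ((Fin.castLE hln i : Fin n) : ℕ) < s := i.2.trans_le hls
  simp only [Function.comp_apply, dif_pos h]
  rfl

/-- A specialization at a point with nonzero coordinates maps a saturation with respect to the
variables to the saturation of the specialized ideal. -/
theorem specialize_mem_saturation {s : ℕ} {b : Fin (n - s) → K} (hb : ∀ i, b i ≠ 0)
    {f : Fin r → MvPolynomial (Fin n) K} {g : MvPolynomial (Fin n) K}
    (hg : g ∈ saturation (Ideal.span (Set.range f)) (∏ i, X i)) :
    specialize n s b g ∈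
      saturation (Ideal.span (Set.range fun j => specialize n s b (f j))) (∏ i, X i) := by
  obtain ⟨N, hN⟩ := hg
  -- Each of the n factors becomes a variable or a nonzero constant, so it divides the product of
  -- the remaining variables.
  have hdvd : specialize n s b (∏ i, X i) ∣ (∏ i, X i) ^ n := by
    rw [map_prod]
    conv_rhs => rw [← Finset.card_fin n, ← Finset.prod_const]
    refine Finset.prod_dvd_prod_of_dvd _ _ fun i _ => ?_
    rw [specialize, aeval_X]
    split_ifs
    · exact Finset.dvd_prod_of_mem _ (Finset.mem_univ _)
    · exact ((hb _).isUnit.map C).dvd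
  have hmem : specialize n s b ((∏ i, X i) ^ N * g) ∈
      Ideal.span (Set.range fun j => specialize n s b (f j)) := by
    have := Ideal.mem_map_of_mem (specialize n s b) hN
    rwa [Ideal.map_span, ← Set.range_comp] at this
  refine ⟨n * N, ?_⟩
  obtain ⟨e, he⟩ := pow_dvd_pow_of_dvd hdvd N
  rw [pow_mul, he, mul_comm _ e, mul_assoc, ← map_pow, ← map_mul]
  exact Ideal.mul_mem_left _ _ hmem

/-- Modulo an ideal containing the polynomials `X_i - b_i`, specializing the last variables to `b`
changes nothing. -/
theorem rename_specialize_sub_mem {s : ℕ} (hsn : s ≤ n) {b : Fin (n - s) → K}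
    {Q : Ideal (MvPolynomial (Fin n) K)}
    (hQ : ∀ i : Fin n, ∀ h : s ≤ (i : ℕ), X i - C (b ⟨i - s, by omega⟩) ∈ Q)
    (g : MvPolynomial (Fin n) K) :
    rename (Fin.castLE hsn) (specialize n s b g) - g ∈ Q := by
  rw [← Ideal.Quotient.eq]
  have : ((Ideal.Quotient.mkₐ K Q).comp (rename (Fin.castLE hsn))).comp (specialize n s b) =
      Ideal.Quotient.mkₐ K Q := by
    refine MvPolynomial.algHom_ext fun i => ?_
    simp only [AlgHom.comp_apply, specialize, aeval_X, Ideal.Quotient.mkₐ_eq_mk]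
    rw [Ideal.Quotient.eq]
    split_ifs with h
    · rw [rename_X]
      simp
    · rw [rename_C, ← neg_sub]
      exact Q.neg_mem (hQ i (not_lt.mp h))
  exact DFunLike.congr_fun this g

theorem comap_saturation_le_of_prime {s : ℕ} (hts : t ≤ s) (hsn : s ≤ n) (hls : l ≤ s)
    (hln : l ≤ n) (htl : t ≤ l) {b : Fin (n - s) → K}
    {f : Fin r → MvPolynomial (Fin n) K} {P Q : Ideal (MvPolynomial (Fin n) K)} [P.IsPrime]
    [hQ : Q.IsPrime] (hPQ : P ≤ Q) (hf : ∀ j, f j ∈ P) (hX : (∏ i, X i) ∉ Q)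
    (hbase : IsTranscendenceBasis K fun i : Fin t =>
      Ideal.Quotient.mk (P.comap (rename (Fin.castLE hln) :
        MvPolynomial (Fin l) K →ₐ[K] MvPolynomial (Fin n) K)) (X (Fin.castLE htl i)))
    (hQb : ∀ p : MvPolynomial (OuterIndex n t s) K,
      rename Subtype.val p ∈ Q ↔ specializeOuter n t s b p = 0) :
    (saturation (Ideal.span (Set.range fun j => specialize n s b (f j))) (∏ i, X i)).comap
        (rename (Fin.castLE hls) : MvPolynomial (Fin l) K →ₐ[K] MvPolynomial (Fin s) K) ≤
      P.comap (rename (Fin.castLE hln) :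
        MvPolynomial (Fin l) K →ₐ[K] MvPolynomial (Fin n) K) := by
  -- Q contains every X_i - b_i with index at least s, because `specializeOuter` kills it.
  have hsub := rename_specialize_sub_mem hsn (b := b) (Q := Q) fun i h => by
    have : rename Subtype.val
        (X ⟨i, Or.inr h⟩ - C (b ⟨i - s, by omega⟩) : MvPolynomial (OuterIndex n t s) K) ∈ Q := by
      have hit : ¬ (i : ℕ) < t := by omega
      rw [hQb, specializeOuter, map_sub, aeval_X, dif_neg hit]
      simp [algebraMap_eq]
    simpa using this
  rintro g ⟨N, hN⟩
  by_contra hg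
  have hgQ : rename (Fin.castLE hln) g ∈ Q := by
    have hspan : Ideal.span (Set.range fun j => specialize n s b (f j)) ≤
        Q.comap (rename (Fin.castLE hsn) : _ →ₐ[K] MvPolynomial (Fin n) K) := by
      rw [Ideal.span_le]
      rintro _ ⟨j, rfl⟩
      exact (Submodule.sub_mem_iff_left Q (hPQ (hf j))).mp (hsub (f j))
    have h := hspan hN
    rw [Ideal.mem_comap, map_mul, map_pow] at h
    have hX' : rename (Fin.castLE hsn) (∏ i, (X i : MvPolynomial (Fin s) K)) ∉ Q := by
      intro h
      rw [map_prod, hQ.prod_mem_iff] at h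
      obtain ⟨i, -, hi⟩ := h
      rw [rename_X] at hi
      exact hX (Q.mem_of_dvd (Finset.dvd_prod_of_mem _ (Finset.mem_univ _)) hi)
    have h' : rename (Fin.castLE hsn) (rename (Fin.castLE hls) g) ∈ Q :=
      (hQ.mem_or_mem h).resolve_left fun h => hX' (hQ.mem_of_pow_mem _ h)
    rwa [rename_rename] at h'
  -- A multiple of g is a nonzero p(X_1,…,X_t) modulo P, so p ∈ Q; but specialization leaves p
  -- unchanged, so membership in Q forces p = 0.
  obtain ⟨p, hp, q, hpq⟩ := exists_mul_sub_rename_mem hbase hg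
  have hpQ : rename (Fin.castLE hln) (rename (Fin.castLE htl) p) ∈ Q := by
    have h := hPQ hpq
    rw [map_sub, map_mul] at h
    exact (Submodule.sub_mem_iff_right Q (Q.mul_mem_right _ hgQ)).mp h
  let d : Fin t → OuterIndex n t s := fun i => ⟨⟨i, by omega⟩, Or.inl i.2⟩
  have hd : Fin.castLE hln ∘ Fin.castLE htl = Subtype.val ∘ d := rfl
  rw [rename_rename, hd, ← rename_rename, hQb] at hpQ
  refine hp ?_
  rw [← hpQ, specializeOuter, aeval_rename]
  conv_lhs => rw [← aeval_X_left_apply p]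
  congr 2
  funext i
  have hi : ((d i).1 : ℕ) < t := i.2
  rw [Function.comp_apply, dif_pos hi]

end Specialization

/-! ### The ideal of the projection -/

theorem nonempty_of_card_le_minkowskiDim {n r : ℕ} {A : Fin r → Finset (Fin n →₀ ℕ)}
    (hA : ∀ J : Finset (Fin r), J.card ≤ minkowskiDim A J) (j : Fin r) : (A j).Nonempty := by
  by_contra h
  rw [Finset.not_nonempty_iff_eq_empty] at h
  have := hA {j}
  simp [minkowskiDim, h] at this

theorem mainTheorem6 (n r t l : ℕ) (hr : 0 < r) (hln : l ≤ n) (htl : t ≤ l) (htrn : t + r ≤ n)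
    (A : Fin r → Finset (Fin n →₀ ℕ))
    (hA : ∀ J : Finset (Fin r), J.card ≤ minkowskiDim A J)
    -- `{X_1, …, X_t}` is a transcendence basis of the function field of the closed projection
    (hbase : IsTranscendenceBasis (CoeffField A) fun i : Fin t =>
      coordFunction (CoeffField A)
        (zariskiClosure (proj (AlgebraicClosure (CoeffField A)) hln ''
          Vstar (AlgebraicClosure (CoeffField A)) (genericPoly A)))
        (Fin.castLE htl i))
    -- `{X_1, …, X_t, X_{t+r+1}, …, X_n}` is a transcendence basis of `K(V^*(f))`
    (htop : IsTranscendenceBasis (CoeffField A)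
      fun i : {i : Fin n // (i : ℕ) < t ∨ t + r ≤ (i : ℕ)} =>
        coordFunction (CoeffField A)
          (Vstar (AlgebraicClosure (CoeffField A)) (genericPoly A)) i.1) :
    ∃ hltr : l ≤ t + r,
    ∃ O : Set (Fin (n - (t + r)) → AlgebraicClosure (CoeffField A)),
      IsZariskiOpen O ∧ IsZariskiDense O ∧
      ∀ b : Fin (n - (t + r)) → CoeffField A,
        (fun i => algebraMap (CoeffField A) (AlgebraicClosure (CoeffField A)) (b i)) ∈ O →
        vanishingIdeal (CoeffField A)
            (zariskiClosure (proj (AlgebraicClosure (CoeffField A)) hln ''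
              Vstar (AlgebraicClosure (CoeffField A)) (genericPoly A))) =
          (saturation
            (Ideal.span (Set.range fun j : Fin r => specialize n (t + r) b (genericPoly A j)))
            (∏ i : Fin (t + r), (X i : MvPolynomial (Fin (t + r)) (CoeffField A)))).comap
          (rename (Fin.castLE hltr) :
            MvPolynomial (Fin l) (CoeffField A) →ₐ[CoeffField A]
              MvPolynomial (Fin (t + r)) (CoeffField A)) := by
  -- Nonempty supports give every f_j a coefficient to solve for.
  have hprime := isPrime_saturation_genericPoly (nonempty_of_card_le_minkowskiDim hA)
  have hV := vanishingIdeal_Vstar (L := AlgebraicClosure (CoeffField A)) (genericPoly A) hprime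
  have hW := vanishingIdeal_proj_image (k := CoeffField A) hln
    (Vstar (AlgebraicClosure (CoeffField A)) (genericPoly A))
  rw [← vanishingIdeal_zariskiClosure] at hW
  have htop' := isTranscendenceBasis_mk_of_fractionRing htop
  have hbase' := isTranscendenceBasis_mk_of_fractionRing hbase
  have hne : vanishingIdeal (CoeffField A)
      (Vstar (AlgebraicClosure (CoeffField A)) (genericPoly A)) ≠ ⊤ := by
    intro h
    have := (algebraicIndependent_mk_iff.mp htop'.1) 1 (by rw [h]; trivial)
    exact one_ne_zero this
  rw [hW] at hbase'
  rw [hW]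
  clear hW hbase htop
  rw [hV] at hne htop' hbase' ⊢
  have hP := hprime hne
  set P := saturation (Ideal.span (Set.range (genericPoly A))) (∏ i, X i)
  have hfP : ∀ j, genericPoly A j ∈ P := fun j => ⟨0, by
    simpa using Ideal.subset_span (Set.mem_range_self j)⟩
  have hXP : (∏ i, X i) ∉ P := by
    rintro ⟨N, hN⟩
    refine hne ((Ideal.eq_top_iff_one _).mpr ⟨N + 1, ?_⟩)
    rwa [mul_one, pow_succ]
  have hltr := le_add_of_isTranscendenceBasis hr hln htl hbase' htop'.1
  obtain ⟨a, ha, hlift⟩ := exists_ne_zero_forall_exists_prime htop' hXP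
  obtain ⟨w, hw, hwa⟩ := exists_ne_zero_forall_specializeOuter_ne_zero (Nat.le_add_right t r) htrn ha
  -- The factor `w` makes the lift Q exist; the product of variables keeps the coordinates of b
  -- nonzero, as the forward inclusion requires.
  let v : MvPolynomial (Fin (n - (t + r))) (AlgebraicClosure (CoeffField A)) :=
    map (algebraMap (CoeffField A) _) (w * ∏ i, X i)
  have hv : v ≠ 0 := by
    rw [Ne, map_eq_zero_iff _ (map_injective _ (algebraMap (CoeffField A) _).injective)]
    exact mul_ne_zero hw (Finset.prod_ne_zero_iff.mpr fun i _ => X_ne_zero i)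
  refine ⟨hltr, {x | aeval x v ≠ 0}, isZariskiOpen_setOf_aeval_ne_zero v,
    isZariskiDense_setOf_aeval_ne_zero hv, fun b hb => ?_⟩
  have hb' : aeval b (w * ∏ i, X i) ≠ 0 := by
    intro h
    refine hb ?_
    rw [aeval_map_algebraMap]
    have := aeval_algebraMap_apply (AlgebraicClosure (CoeffField A)) b (w * ∏ i, X i)
    rw [h, map_zero] at this
    exact this
  rw [map_mul, map_prod] at hb'
  simp only [aeval_X] at hb'
  have hb0 : ∀ i, b i ≠ 0 := fun i =>
    Finset.prod_ne_zero_iff.mp (right_ne_zero_of_mul hb') i (Finset.mem_univ i)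
  obtain ⟨Q, hQ, hPQ, hXQ, hQb⟩ := hlift (specializeOuter n t (t + r) b)
    (hwa b (left_ne_zero_of_mul hb'))
  refine le_antisymm (fun g hg => ?_) ?_
  · rw [Ideal.mem_comap, ← specialize_rename_castLE hltr hln b]
    exact specialize_mem_saturation hb0 hg
  · exact comap_saturation_le_of_prime (Nat.le_add_right t r) htrn hltr hln htl hPQ hfP hXQ hbase' hQb
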